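/- Let $P_\ell(t)=\frac{1}{2^\ell \ell!}\frac{d^\ell}{dt^\ell}(t^2-1)^\ell$ be the Legendre polynomials and let $Y_{m\ell}$, $-\ell\le m\le \ell$, be the standard ($L^2(\mathbb S^2)$-normalised, complex) spherical harmonics on the unit sphere $\mathbb S^2\subset\mathbb R^3$. Fix $\ell\ge 1$ and $C_\ell>0$, and let $f_\ell(x)=\sum_{m=-\ell}^{\ell}a_{m\ell}Y_{m\ell}(x)$, $x\in\mathbb S^2$, be the degree-$\ell$ Fourier component of a real Gaussian isotropic random field: the $a_{m\ell}$ are jointly Gaussian centred complex random variables with $\mathbb E[a_{m\ell}\overline{a_{m'\ell}}]=C_\ell\,\delta_{mm'}$, and $f_\ell$ is real-valued. Write $f_\ell(\theta)$ for the value of $f_\ell$ at the point with azimuth $0$ and polar angle $\theta$, and put $$V_{N,\ell}=\sum_{i=1}^N\Big(f_\ell\big(\tfrac{i+1}{N}\tfrac{\pi}{2}\big)-f_\ell\big(\tfrac{i}{N}\tfrac{\pi}{2}\big)\Big)^2,\qquad F_N=\frac{V_{N,\ell}-\mathbb E V_{N,\ell}}{\sqrt{\operatorname{Var}(V_{N,\ell})}},$$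 $$g_\ell(u)=\ell(\ell+1)P_\ell\big(\cos(u\tfrac{\pi}{2})\big)-P_\ell'\big(\cos(u\tfrac{\pi}{2})\big)\cos\big(u\tfrac{\pi}{2}\big).$$ Then, as $N\to\infty$, $F_N$ converges in distribution to a non-Gaussian random variable $F$ which has exponential moments in a neighbourhood of $0$, and whose cumulants $\kappa_p(F)=\frac{d^p}{dt^p}\log\mathbb E[e^{tF}]\big|_{t=0}$ are $\kappa_1(F)=0$, $\kappa_2(F)=1$ and, for every $p\ge 3$, $$\kappa_p(F)=\frac{2^{p-1}(p-1)!}{2^{p/2}\Big(\int_0^1\int_0^1 g_\ell(|x-y|)^2\,dx\,dy\Big)^{p/2}}\int_{[0,1]^p}g_\ell(|x_1-x_2|)\cdots g_\ell(|x_{p-1}-x_p|)\,g_\ell(|x_p-x_1|)\,dx_1\cdots dx_p .$$ -/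

import Mathlib

open MeasureTheory ProbabilityTheory Filter Topology

noncomputable section

namespace SphereQV

/-- The Legendre polynomial `P_ℓ`, by Rodrigues' formula
`P_ℓ(t) = 1 / (2 ^ ℓ ℓ!) * d^ℓ/dt^ℓ (t ^ 2 - 1) ^ ℓ`. -/
def legendre (l : ℕ) : Polynomial ℝ :=
  Polynomial.C (1 / ((2 : ℝ) ^ l * (l.factorial : ℝ))) *
    (Polynomial.derivative^[l]) ((Polynomial.X ^ 2 - 1) ^ l)

/-- The unit sphere `𝕊²` in Euclidean three-space. -/
abbrev Sphere2 : Type := Metric.sphere (0 : EuclideanSpace ℝ (Fin 3)) 1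

/-- The point of `𝕊²` with azimuth `φ` and polar angle `θ`. -/
def spherePoint (φ θ : ℝ) : Sphere2 :=
  ⟨!₂[Real.sin θ * Real.cos φ, Real.sin θ * Real.sin φ, Real.cos θ], by
    rw [mem_sphere_zero_iff_norm, EuclideanSpace.norm_eq, Real.sqrt_eq_one, Fin.sum_univ_three]
    simp only [Real.norm_eq_abs, sq_abs]
    simp
    nlinarith [Real.sin_sq_add_cos_sq θ, Real.sin_sq_add_cos_sq φ]⟩

/-- The spherical harmonic `Y_{kℓ}` of order `0 ≤ k ≤ ℓ`, Condon-Shortley convention: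
`(-1)^k √((2ℓ+1)/(4π) (ℓ-k)!/(ℓ+k)!) sin^k θ P_ℓ^{(k)}(cos θ) e^{ikφ}`, with
`sin^k θ e^{ikφ} = (x₀ + i x₁)^k` and `cos θ = x₂` in Cartesian coordinates. -/
def sphericalHarmonicNonneg (l k : ℕ) (x : Sphere2) : ℂ :=
  (((-1 : ℝ) ^ k * Real.sqrt ((2 * (l : ℝ) + 1) / (4 * Real.pi) *
      (((l - k).factorial : ℝ) / ((l + k).factorial : ℝ))) : ℝ) : ℂ) *
    ((x.1 0 : ℂ) + Complex.I * (x.1 1 : ℂ)) ^ k *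
    ((((Polynomial.derivative^[k]) (legendre l)).eval (x.1 2) : ℝ) : ℂ)

/-- The spherical harmonic `Y_{mℓ}`, `-ℓ ≤ m ≤ ℓ`; for negative order
`Y_{-k,ℓ} = (-1)^k * conj Y_{kℓ}`. -/
def sphericalHarmonic (l : ℕ) (m : ℤ) (x : Sphere2) : ℂ :=
  if 0 ≤ m then sphericalHarmonicNonneg l m.natAbs x
  else (-1 : ℂ) ^ m.natAbs * (starRingEnd ℂ) (sphericalHarmonicNonneg l m.natAbs x)

/-- The set of orders `-ℓ ≤ m ≤ ℓ` of the spherical harmonics of degree `ℓ`. -/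
abbrev Orders (l : ℕ) : Type := Finset.Icc (-(l : ℤ)) (l : ℤ)

/-- The degree `ℓ` Fourier component `f_ℓ(x) = ∑_{m=-ℓ}^{ℓ} a_{mℓ} Y_{mℓ}(x)`, as a complex number. -/
def componentC {Ω : Type*} (l : ℕ) (a : Orders l → Ω → ℂ) (x : Sphere2) (ω : Ω) : ℂ :=
  ∑ m : Orders l, a m ω * sphericalHarmonic l m x

/-- `a` is the family of degree `ℓ` random coefficients `a_{mℓ}` of a real isotropic Gaussian random
field on `𝕊²` with angular power `C_ℓ = C` at degree `ℓ`: jointly Gaussian and centred complex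
variables with `E[a_{mℓ} conj a_{m'ℓ}] = C δ_{mm'}`, such that `f_ℓ` is a real field. -/
structure IsIsotropicCoeff {Ω : Type*} [MeasurableSpace Ω] (P : Measure Ω) (l : ℕ) (C : ℝ)
    (a : Orders l → Ω → ℂ) : Prop where
  gaussian : HasGaussianLaw (fun ω m => a m ω) P
  centred : ∀ m, ∫ ω, a m ω ∂P = 0
  covariance : ∀ m m', ∫ ω, a m ω * (starRingEnd ℂ) (a m' ω) ∂P = if m = m' then (C : ℂ) else 0
  real : ∀ x : Sphere2, ∀ᵐ ω ∂P, (componentC l a x ω).im = 0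

/-- The field `f_ℓ`, as a real number (it is almost surely real under `IsIsotropicCoeff`). -/
def component {Ω : Type*} (l : ℕ) (a : Orders l → Ω → ℂ) (x : Sphere2) (ω : Ω) : ℝ :=
  (componentC l a x ω).re

/-- The quadratic variation `V_{N,ℓ} = ∑_{i=1}^N (f_ℓ((i+1)/N π/2) - f_ℓ(i/N π/2))²`, where
`f_ℓ(θ)` is the value at the point with azimuth `0` and polar angle `θ`. -/
def quadVar {Ω : Type*} (l : ℕ) (a : Orders l → Ω → ℂ) (N : ℕ) (ω : Ω) : ℝ :=
  ∑ i ∈ Finset.Icc 1 N,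
    (component l a (spherePoint 0 (((i : ℝ) + 1) / (N : ℝ) * (Real.pi / 2))) ω -
      component l a (spherePoint 0 ((i : ℝ) / (N : ℝ) * (Real.pi / 2))) ω) ^ 2

/-- The normalised quadratic variation `F_N = (V_{N,ℓ} - E V_{N,ℓ}) / √Var(V_{N,ℓ})`. -/
def normQuadVar {Ω : Type*} [MeasurableSpace Ω] (P : Measure Ω) (l : ℕ) (a : Orders l → Ω → ℂ)
    (N : ℕ) (ω : Ω) : ℝ :=
  (quadVar l a N ω - ∫ ω', quadVar l a N ω' ∂P) / Real.sqrt (variance (quadVar l a N) P)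

/-- `g_ℓ(u) = ℓ(ℓ+1) P_ℓ(cos(u π/2)) - P_ℓ'(cos(u π/2)) cos(u π/2)`. -/
def kernel (l : ℕ) (u : ℝ) : ℝ :=
  (l : ℝ) * ((l : ℝ) + 1) * (legendre l).eval (Real.cos (u * (Real.pi / 2))) -
    (Polynomial.derivative (legendre l)).eval (Real.cos (u * (Real.pi / 2))) *
      Real.cos (u * (Real.pi / 2))

/-- The cyclic integral `∫_{[0,1]^p} g_ℓ(|x₁-x₂|) ⋯ g_ℓ(|x_{p-1}-x_p|) g_ℓ(|x_p-x₁|) dx₁⋯dx_p`;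
`finRotate p` is the cyclic shift of the indices. -/
def cyclicIntegral (l p : ℕ) : ℝ :=
  ∫ x in Set.Icc (0 : Fin p → ℝ) 1, ∏ i : Fin p, kernel l |x i - x (finRotate p i)|

/-- The normalising integral `∫_0^1 ∫_0^1 g_ℓ(|x-y|)² dx dy`. -/
def kernelSq (l : ℕ) : ℝ :=
  ∫ x in (0 : ℝ)..1, ∫ y in (0 : ℝ)..1, kernel l |x - y| ^ 2

/-- The cumulant of order `p` of a probability law on `ℝ`: the `p`-th derivative at `0` of
`t ↦ log E[exp(tF)]`. To be used for laws with exponential moments near `0`. -/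
def cumulant (p : ℕ) (μ : Measure ℝ) : ℝ :=
  iteratedDeriv p (cgf id μ) 0

end SphereQV

end

/-! On the meridian every spherical harmonic is real, so $f_\ell$ there is a finite sum $\sum_m
\psi_m(u)\,\mathrm{Re}\,a_m$ of smooth profiles with a fixed Gaussian vector of coefficients. Hence
$N V_N$ is a quadratic form in that vector whose matrix tends entrywise to the Gram matrix $G$ of
the $\psi_m'$ on $[0,1]$ (`tendsto_sum_increment_mul`). Standardising removes the factor $N$, so
$F_N$ converges for every $\omega$ to the standardised $\int_0^1 (\partial_u f_\ell)^2\,du$. All the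
randomness is finite-dimensional, and no central limit effect occurs.

The limit is diagonalised as $\sum_i \eta_i^2$ with independent centred Gaussians of variances $d_i$
(`exists_quadForm_eq_sum_sq`). Its cumulants are $2^{p-1}(p-1)!\sum_i d_i^p$ for $p\ge 1$, and
$\sum_i d_i^p$ is the trace of $(GS)^p$, with $S$ the second moment matrix of the coefficients. That
trace is the cyclic integral of the covariance of $\partial_u f_\ell$
(`integral_cyclic_prod_eq_trace`). By the addition theorem and the Legendre equation this covariance
is a positive constant times $g_\ell(u-v)$ (`sum_deriv_profile_mul_momentMatrix`), and the constant
cancels on standardising. A positive fourth cumulant excludes Gaussian limits. -/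

noncomputable section

namespace SphereQV

/-! ### Legendre polynomials and their differential equation -/

open Polynomial in
/-- The differential equation satisfied by the derivatives of `(X ^ 2 - 1) ^ l`. -/
lemma iterate_derivative_sq_sub_one_pow (l n : ℕ) :
    ((X : ℝ[X]) ^ 2 - 1) * derivative^[n + 2] ((X ^ 2 - 1) ^ l) =
      C (2 * ((l : ℝ) - 1 - n)) * X * derivative^[n + 1] ((X ^ 2 - 1) ^ l) +
        C (((n : ℝ) + 1) * (2 * l - n)) * derivative^[n] ((X ^ 2 - 1) ^ l) := by
  -- The first-order equation of $(X^2-1)^l$; differentiating it once starts the induction, and each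
  -- further derivative raises $n$ by one.
  have base : ((X : ℝ[X]) ^ 2 - 1) * derivative ((X ^ 2 - 1) ^ l) =
      C (2 * (l : ℝ)) * X * (X ^ 2 - 1) ^ l := by
    rcases l with _ | l
    · simp
    · rw [derivative_pow_succ]
      simp only [derivative_sub, derivative_X_pow, derivative_one, map_mul, map_add, map_natCast,
        map_ofNat, C_1, Nat.cast_add, Nat.cast_one]
      simp
      ring
  induction n with
  | zero =>
    have h := congrArg derivative base
    simp only [derivative_mul, derivative_sub, derivative_X_pow, derivative_one, derivative_C,
      derivative_X] at h
    simp only [Function.iterate_succ, Function.iterate_zero, Function.comp_apply, id_eq]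
    simp at h ⊢
    linear_combination h
  | succ n ih =>
    have h := congrArg derivative ih
    simp only [derivative_mul, derivative_add, derivative_sub, derivative_X_pow, derivative_one,
      derivative_C, derivative_X, ← Function.iterate_succ_apply' (f := ⇑derivative)] at h
    rw [show n + 1 + 2 = n + 3 from rfl, show n + 1 + 1 = n + 2 from rfl]
    have h2 : (C 2 : ℝ[X]) = 2 := map_ofNat C 2
    simp [h2] at h ⊢
    linear_combination h

open Polynomial in
/-- The `k` times differentiated Legendre equation. -/
lemma legendre_equation (l k : ℕ) (t : ℝ) :
    (t ^ 2 - 1) * (derivative^[k + 2] (legendre l)).eval t =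
      -(2 * ((k : ℝ) + 1)) * t * (derivative^[k + 1] (legendre l)).eval t +
        ((l : ℝ) + k + 1) * (l - k) * (derivative^[k] (legendre l)).eval t := by
  -- Rodrigues' formula shifts the order by $l$: at $n = k+l$ the coefficients become $-2(k+1)$ and
  -- $(l+k+1)(l-k)$.
  have h := congrArg (eval t) (iterate_derivative_sq_sub_one_pow l (k + l))
  have e : ∀ j, derivative^[j] (legendre l) =
      C (1 / ((2 : ℝ) ^ l * (l.factorial : ℝ))) * derivative^[j + l] ((X ^ 2 - 1) ^ l) := by
    intro j
    rw [legendre, iterate_derivative_C_mul, ← Function.iterate_add_apply]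
  rw [e, e, e, show k + 2 + l = k + l + 2 by ring, show k + 1 + l = k + l + 1 by ring]
  simp only [eval_mul, eval_add, eval_sub, eval_pow, eval_X, eval_one, eval_C] at h ⊢
  push_cast at h
  linear_combination (1 / ((2 : ℝ) ^ l * (l.factorial : ℝ))) * h

open Polynomial in
lemma iterate_derivative_legendre_eq_zero (l : ℕ) : derivative^[l + 1] (legendre l) = 0 := by
  rw [legendre, iterate_derivative_C_mul, ← Function.iterate_add_apply,
    iterate_derivative_eq_zero, mul_zero]
  have h : ((X : ℝ[X]) ^ 2 - 1).natDegree ≤ 2 := by compute_degree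
  calc (((X : ℝ[X]) ^ 2 - 1) ^ l).natDegree ≤ l * ((X : ℝ[X]) ^ 2 - 1).natDegree :=
        natDegree_pow_le
    _ ≤ l * 2 := Nat.mul_le_mul_left _ h
    _ < l + 1 + l := by omega

open Polynomial in
lemma legendre_eval_one (l : ℕ) : (legendre l).eval 1 = 1 := by
  have h : (derivative^[l] (((X : ℝ[X]) ^ 2 - 1) ^ l)).eval 1 = 2 ^ l * (l.factorial : ℝ) := by
    -- The $l$-th derivative at 1 is $l!$ times the Taylor coefficient of order $l$ there, namely
    -- $2^l$.
    have h1 : taylor 1 (((X : ℝ[X]) ^ 2 - 1) ^ l) = X ^ l * (X + C 2) ^ l := by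
      rw [taylor_apply, pow_comp, ← mul_pow]
      congr 1
      simp [show (C 2 : ℝ[X]) = 2 from map_ofNat C 2]
      ring
    rw [← factorial_smul_hasseDeriv, LinearMap.smul_apply, eval_smul, ← taylor_coeff, h1]
    have := coeff_X_pow_mul ((X + C (2 : ℝ)) ^ l) l 0
    rw [zero_add] at this
    rw [this, coeff_zero_eq_eval_zero]
    simp [mul_comm]
  rw [legendre, eval_mul, eval_C, h]
  have : (2 : ℝ) ^ l * (l.factorial : ℝ) ≠ 0 := by positivity
  field_simp

/-! ### Associated Legendre functions and the addition theorem on a meridian -/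

/-- The unnormalised associated Legendre function `θ ↦ sin^k θ P_ℓ^{(k)}(cos θ)`. -/
def assocLegendre (l k : ℕ) (θ : ℝ) : ℝ :=
  Real.sin θ ^ k * ((Polynomial.derivative^[k]) (legendre l)).eval (Real.cos θ)

lemma contDiff_assocLegendre (l k : ℕ) : ContDiff ℝ 2 (assocLegendre l k) := by
  unfold assocLegendre
  exact (Real.contDiff_sin.pow k).mul
    ((((Polynomial.derivative^[k] (legendre l)).contDiff_aeval (𝕜 := ℝ) 2)).comp Real.contDiff_cos)

lemma hasDerivAt_assocLegendre_zero (l : ℕ) (θ : ℝ) :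
    HasDerivAt (assocLegendre l 0) (-assocLegendre l 1 θ) θ := by
  have h := ((legendre l).hasDerivAt (Real.cos θ)).comp θ (Real.hasDerivAt_cos θ)
  convert! h using 1
  · ext; simp [assocLegendre]
  · simp [assocLegendre]; ring

/-- The ladder relation for associated Legendre functions. -/
lemma hasDerivAt_assocLegendre_succ (l k : ℕ) (θ : ℝ) :
    HasDerivAt (assocLegendre l (k + 1))
      ((((l : ℝ) + k + 1) * (l - k) * assocLegendre l k θ - assocLegendre l (k + 2) θ) / 2) θ := by
  have h := ((Real.hasDerivAt_sin θ).pow (k + 1)).mul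
    (((Polynomial.derivative^[k + 1] (legendre l)).hasDerivAt (Real.cos θ)).comp θ
      (Real.hasDerivAt_cos θ))
  convert! h using 1
  -- Trading half of the $\sin^{k+2}\theta\,P^{(k+2)}$ term through this equation cancels the cosine
  -- term.
  have e := legendre_equation l k (Real.cos θ)
  rw [Real.cos_sq'] at e
  simp only [assocLegendre, Function.comp_apply, Pi.pow_apply,
    ← Function.iterate_succ_apply' (f := ⇑Polynomial.derivative)]
  push_cast
  linear_combination (-Real.sin θ ^ k / 2) * e

/-- The weight `(ℓ-k)!/(ℓ+k)!`. -/
def harmonicWeight (l k : ℕ) : ℝ := ((l - k).factorial : ℝ) / ((l + k).factorial : ℝ)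

lemma harmonicWeight_succ {l k : ℕ} (h : k < l) :
    harmonicWeight l (k + 1) * (((l : ℝ) + k + 1) * (l - k)) = harmonicWeight l k := by
  obtain ⟨j, rfl⟩ := Nat.exists_eq_add_of_lt h
  unfold harmonicWeight
  rw [show k + j + 1 - (k + 1) = j by omega, show k + j + 1 - k = j + 1 by omega,
    show k + j + 1 + (k + 1) = (k + j + 1 + k) + 1 by ring, Nat.factorial_succ, Nat.factorial_succ]
  have : (((k + j + 1 + k).factorial : ℕ) : ℝ) ≠ 0 := by positivity
  have : ((k : ℝ) + j + 1 + k + 1) ≠ 0 := by positivity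
  push_cast
  field_simp
  ring

/-- The zonal kernel along a meridian, as a sum over orders. -/
def meridianKernel (l : ℕ) (x y : ℝ) : ℝ :=
  harmonicWeight l 0 * (assocLegendre l 0 x * assocLegendre l 0 y) +
    2 * ∑ k ∈ Finset.range l,
      harmonicWeight l (k + 1) * (assocLegendre l (k + 1) x * assocLegendre l (k + 1) y)

/-- By the ladder relations and `harmonicWeight_succ` the derivative telescopes. The upper end
vanishes because $P_\ell^{(\ell+1)}=0$, and the lower end cancels the derivative of the order 0
term. Thus the kernel depends only on $x-y$. -/
lemma hasDerivAt_meridianKernel_diag (l : ℕ) (x y s : ℝ) :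
    HasDerivAt (fun s => meridianKernel l (x + s) (y + s)) 0 s := by
  have d0 := fun z => HasDerivAt.comp_const_add z s (hasDerivAt_assocLegendre_zero l (z + s))
  have d1 := fun z k =>
    HasDerivAt.comp_const_add z s (hasDerivAt_assocLegendre_succ l k (z + s))
  have h := (((d0 x).mul (d0 y)).const_mul (harmonicWeight l 0)).add
    ((HasDerivAt.fun_sum (u := Finset.range l) fun k _ =>
      ((d1 x k).mul (d1 y k)).const_mul (harmonicWeight l (k + 1))).const_mul 2)
  convert! h using 1
  set B : ℕ → ℝ := fun k => harmonicWeight l k *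
    (assocLegendre l k (x + s) * assocLegendre l (k + 1) (y + s) +
      assocLegendre l (k + 1) (x + s) * assocLegendre l k (y + s)) with hB
  have ht : B l = 0 := by
    have : ∀ z, assocLegendre l (l + 1) z = 0 := fun z => by
      rw [assocLegendre, iterate_derivative_legendre_eq_zero]; simp
    simp [hB, this]
  have hs := Finset.sum_range_sub' B l
  rw [ht, sub_zero] at hs
  have hterm : ∀ k ∈ Finset.range l, 2 * (harmonicWeight l (k + 1) *
      ((((l : ℝ) + k + 1) * (l - k) * assocLegendre l k (x + s) -
        assocLegendre l (k + 2) (x + s)) / 2 * assocLegendre l (k + 1) (y + s) +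
       assocLegendre l (k + 1) (x + s) * ((((l : ℝ) + k + 1) * (l - k) *
        assocLegendre l k (y + s) - assocLegendre l (k + 2) (y + s)) / 2))) =
      B k - B (k + 1) := by
    intro k hk
    have w := harmonicWeight_succ (Finset.mem_range.mp hk)
    simp only [hB, ← w]
    ring
  rw [Finset.mul_sum, Finset.sum_congr rfl hterm, hs]
  simp only [hB]
  ring

/-- Translation invariance moves $y$ to the pole, where $\sin 0 = 0$ kills every order but 0 and
$P_\ell(1)=1$. -/
lemma meridianKernel_eq (l : ℕ) (x y : ℝ) :
    meridianKernel l x y = (legendre l).eval (Real.cos (x - y)) := by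
  have hc := is_const_of_deriv_eq_zero
    (f := fun s => meridianKernel l (x + s) (y + s))
    (fun s => (hasDerivAt_meridianKernel_diag l x y s).differentiableAt)
    (fun s => (hasDerivAt_meridianKernel_diag l x y s).deriv) 0 (-y)
  simp only [add_zero, add_neg_cancel] at hc
  rw [hc, ← sub_eq_add_neg]
  simp [meridianKernel, assocLegendre, harmonicWeight, legendre_eval_one, div_self,
    Nat.factorial_ne_zero]

/-- The restriction of a spherical harmonic to the meridian of azimuth `0`. -/
def meridianHarmonic (l : ℕ) (m : ℤ) (θ : ℝ) : ℝ :=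
  (-1) ^ m.natAbs * Real.sqrt ((2 * (l : ℝ) + 1) / (4 * Real.pi) * harmonicWeight l m.natAbs) *
    assocLegendre l m.natAbs θ * (if 0 ≤ m then 1 else (-1) ^ m.natAbs)

lemma sphericalHarmonic_spherePoint_zero (l : ℕ) (m : ℤ) (θ : ℝ) :
    sphericalHarmonic l m (spherePoint 0 θ) = (meridianHarmonic l m θ : ℂ) := by
  have h : sphericalHarmonicNonneg l m.natAbs (spherePoint 0 θ) =
      (((-1) ^ m.natAbs * Real.sqrt ((2 * (l : ℝ) + 1) / (4 * Real.pi) *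
        harmonicWeight l m.natAbs) * assocLegendre l m.natAbs θ : ℝ) : ℂ) := by
    simp [sphericalHarmonicNonneg, spherePoint, assocLegendre, harmonicWeight, mul_assoc]
  unfold sphericalHarmonic meridianHarmonic
  rw [h]
  split_ifs with hm
  · simp
  · rw [Complex.conj_ofReal]
    push_cast
    ring

lemma contDiff_meridianHarmonic (l : ℕ) (m : ℤ) : ContDiff ℝ 2 (meridianHarmonic l m) := by
  unfold meridianHarmonic
  exact (contDiff_const.mul (contDiff_assocLegendre l _)).mul contDiff_const

lemma sum_Icc_neg_natAbs (l : ℕ) (F : ℕ → ℝ) :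
    ∑ m ∈ Finset.Icc (-(l : ℤ)) (l : ℤ), F m.natAbs =
      F 0 + 2 * ∑ k ∈ Finset.range l, F (k + 1) := by
  induction l with
  | zero => simp
  | succ l ih =>
    have e : Finset.Icc (-((l + 1 : ℕ) : ℤ)) ((l + 1 : ℕ) : ℤ) =
        insert (-((l : ℤ) + 1)) (insert ((l : ℤ) + 1) (Finset.Icc (-(l : ℤ)) (l : ℤ))) := by
      ext z
      simp only [Finset.mem_Icc, Finset.mem_insert]
      push_cast
      omega
    rw [e, Finset.sum_insert, Finset.sum_insert, ih, Finset.sum_range_succ]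
    · rw [show (-((l : ℤ) + 1)).natAbs = l + 1 by omega, show ((l : ℤ) + 1).natAbs = l + 1 by omega]
      ring
    · simp
    · simp only [Finset.mem_Icc, Finset.mem_insert]
      omega

/-- The addition theorem for spherical harmonics along a meridian. -/
lemma sum_meridianHarmonic_mul (l : ℕ) (x y : ℝ) :
    ∑ m : Orders l, meridianHarmonic l m x * meridianHarmonic l m y =
      (2 * (l : ℝ) + 1) / (4 * Real.pi) * (legendre l).eval (Real.cos (x - y)) := by
  have h : ∀ m : ℤ, meridianHarmonic l m x * meridianHarmonic l m y =
      (2 * (l : ℝ) + 1) / (4 * Real.pi) * (harmonicWeight l m.natAbs *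
        (assocLegendre l m.natAbs x * assocLegendre l m.natAbs y)) := by
    intro m
    have hs : Real.sqrt ((2 * (l : ℝ) + 1) / (4 * Real.pi) * harmonicWeight l m.natAbs) *
        Real.sqrt ((2 * (l : ℝ) + 1) / (4 * Real.pi) * harmonicWeight l m.natAbs) =
        (2 * (l : ℝ) + 1) / (4 * Real.pi) * harmonicWeight l m.natAbs :=
      Real.mul_self_sqrt (by unfold harmonicWeight; positivity)
    have h1 : ((-1 : ℝ) ^ m.natAbs) * (-1) ^ m.natAbs = 1 := by
      rw [← mul_pow]; simp
    have h2 : (if 0 ≤ m then 1 else (-1 : ℝ) ^ m.natAbs) *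
        (if 0 ≤ m then 1 else (-1) ^ m.natAbs) = 1 := by
      split_ifs
      · simp
      · exact h1
    unfold meridianHarmonic
    calc _ = (((-1 : ℝ) ^ m.natAbs) * (-1) ^ m.natAbs) *
          ((if 0 ≤ m then 1 else (-1 : ℝ) ^ m.natAbs) *
            (if 0 ≤ m then 1 else (-1) ^ m.natAbs)) *
          (Real.sqrt ((2 * (l : ℝ) + 1) / (4 * Real.pi) * harmonicWeight l m.natAbs) *
            Real.sqrt ((2 * (l : ℝ) + 1) / (4 * Real.pi) * harmonicWeight l m.natAbs)) *
          (assocLegendre l m.natAbs x * assocLegendre l m.natAbs y) := by ring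
      _ = _ := by rw [h1, h2, hs]; ring
  simp_rw [h]
  rw [← Finset.mul_sum, ← meridianKernel_eq]
  congr 1
  rw [Finset.sum_coe_sort (Finset.Icc (-(l : ℤ)) (l : ℤ)) (fun m : ℤ => harmonicWeight l m.natAbs *
    (assocLegendre l m.natAbs x * assocLegendre l m.natAbs y)),
    sum_Icc_neg_natAbs l fun k => harmonicWeight l k * (assocLegendre l k x * assocLegendre l k y)]
  rfl

/-! ### The kernel $g_\ell$ as a second derivative -/

lemma kernel_abs (l : ℕ) (u : ℝ) : kernel l |u| = kernel l u := by
  rcases abs_choice u with h | h <;> rw [h]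
  simp [kernel, neg_mul]

lemma continuous_kernel (l : ℕ) : Continuous (kernel l) := by
  unfold kernel
  fun_prop

lemma kernel_zero (l : ℕ) : kernel l 0 = l * (l + 1) / 2 := by
  have e := legendre_equation l 0 1
  simp [legendre_eval_one] at e
  simp [kernel, legendre_eval_one]
  linarith

lemma hasDerivAt_legendre_cos (l : ℕ) (w : ℝ) :
    HasDerivAt (fun w => (legendre l).eval (Real.cos (w * (Real.pi / 2))))
      (-(Real.pi / 2) * (Real.sin (w * (Real.pi / 2)) *
        (Polynomial.derivative (legendre l)).eval (Real.cos (w * (Real.pi / 2))))) w := by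
  have h0 : HasDerivAt (fun w : ℝ => w * (Real.pi / 2)) (Real.pi / 2) w := by
    simpa using (hasDerivAt_id w).mul_const (Real.pi / 2)
  have h := ((legendre l).hasDerivAt _).comp w h0.cos
  convert! h using 1
  ring

/-- The Legendre equation eliminates $P_\ell''$. This is where $g_\ell$ comes from: up to a factor
it is minus the second derivative of the covariance profile. -/
lemma hasDerivAt_deriv_legendre_cos (l : ℕ) (w : ℝ) :
    HasDerivAt (fun w => -(Real.pi / 2) * (Real.sin (w * (Real.pi / 2)) *
        (Polynomial.derivative (legendre l)).eval (Real.cos (w * (Real.pi / 2)))))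
      (-(Real.pi / 2) ^ 2 * kernel l w) w := by
  have h0 : HasDerivAt (fun w : ℝ => w * (Real.pi / 2)) (Real.pi / 2) w := by
    simpa using (hasDerivAt_id w).mul_const (Real.pi / 2)
  have h := (h0.sin.mul
    (((Polynomial.derivative (legendre l)).hasDerivAt _).comp w h0.cos)).const_mul (-(Real.pi / 2))
  convert! h using 1
  have e := legendre_equation l 0 (Real.cos (w * (Real.pi / 2)))
  rw [Real.cos_sq'] at e
  simp [kernel] at e ⊢
  linear_combination -(Real.pi / 2) ^ 2 * e


/-! ### Traces of matrix powers and cyclic integrals -/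

/-- A sum over paths from `a` to `b` with interior vertices `i`: step `k` leaves from the `k`-th
entry of `cons a i` and arrives at that of `snoc i b`. With `b = a` the second list is the rotated
first one, which gives the cyclic form of the trace. -/
lemma pow_succ_apply_eq_sum {ι : Type*} [Fintype ι] [DecidableEq ι] (M : Matrix ι ι ℝ) (n : ℕ)
    (a b : ι) :
    (M ^ (n + 1)) a b = ∑ i : Fin n → ι, ∏ k : Fin (n + 1),
      M ((Fin.cons a i : Fin (n + 1) → ι) k) ((Fin.snoc i b : Fin (n + 1) → ι) k) := by
  induction n generalizing a with
  | zero => simp [Fin.snoc]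
  | succ n ih =>
    rw [pow_succ', Matrix.mul_apply, ← (Fin.consEquiv fun _ => ι).sum_comp, Fintype.sum_prod_type]
    refine Finset.sum_congr rfl fun c _ => ?_
    rw [ih, Finset.mul_sum]
    refine Finset.sum_congr rfl fun i _ => ?_
    rw [Fin.prod_univ_succ (n := n + 1)]
    have hs : (Fin.snoc ((Fin.consEquiv fun _ => ι) (c, i)) b : Fin (n + 2) → ι) =
        Fin.cons c (Fin.snoc i b : Fin (n + 1) → ι) :=
      (Fin.cons_snoc_eq_snoc_cons (β := ι) c i b).symm
    rw [hs]
    rfl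

lemma trace_pow_eq_sum_cyclic {ι : Type*} [Fintype ι] [DecidableEq ι] (M : Matrix ι ι ℝ) (n : ℕ) :
    (M ^ (n + 1)).trace =
      ∑ i : Fin (n + 1) → ι, ∏ k, M (i k) (i (finRotate (n + 1) k)) := by
  rw [← (Fin.consEquiv fun _ => ι).sum_comp, Fintype.sum_prod_type, Matrix.trace]
  refine Finset.sum_congr rfl fun a _ => ?_
  rw [Matrix.diag_apply, pow_succ_apply_eq_sum]
  refine Finset.sum_congr rfl fun i _ => Finset.prod_congr rfl fun k _ => ?_
  rw [Fin.snoc_eq_cons_rotate]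
  rfl

/-- The integral over the unit cube of the cyclic product of a finite rank kernel is a trace. -/
lemma integral_cyclic_prod_eq_trace {ι : Type*} [Fintype ι] [DecidableEq ι] (y z : ι → ℝ → ℝ)
    (hy : ∀ i, Continuous (y i)) (hz : ∀ i, Continuous (z i)) (n : ℕ) :
    ∫ x in Set.Icc (0 : Fin (n + 1) → ℝ) 1,
        ∏ k, ∑ i, y i (x k) * z i (x (finRotate (n + 1) k)) =
      ((Matrix.of fun i j => ∫ u in (0 : ℝ)..1, y i u * z j u) ^ (n + 1)).trace := by
  have hexp : ∀ x : Fin (n + 1) → ℝ,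
      ∏ k, ∑ i, y i (x k) * z i (x (finRotate (n + 1) k)) =
        ∑ i : Fin (n + 1) → ι, ∏ k, (y (i k) (x k) * z (i ((finRotate (n + 1)).symm k)) (x k)) := by
    intro x
    rw [Finset.prod_univ_sum, Fintype.piFinset_univ]
    refine Finset.sum_congr rfl fun i _ => ?_
    rw [Finset.prod_mul_distrib, Finset.prod_mul_distrib]
    congr 1
    rw [← Equiv.prod_comp (finRotate (n + 1)) fun k =>
      z (i ((finRotate (n + 1)).symm k)) (x k)]
    simp only [Equiv.symm_apply_apply]
  simp_rw [hexp]
  rw [integral_finsetSum]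
  -- Collecting the factors in each variable pairs the index `i (finRotate k)` of `y` with `i k` of
  -- `z`, so the transposed matrix appears; its trace is the same.
  · rw [← Matrix.trace_transpose, Matrix.transpose_pow, trace_pow_eq_sum_cyclic]
    refine Finset.sum_congr rfl fun i _ => ?_
    have hr : (volume : Measure (Fin (n + 1) → ℝ)).restrict (Set.Icc 0 1) =
        Measure.pi fun _ => (volume : Measure ℝ).restrict (Set.Icc 0 1) := by
      rw [← Set.pi_univ_Icc, volume_pi, Measure.restrict_pi_pi]
      rfl
    rw [hr, integral_fintype_prod_eq_prod
      (f := fun k u => y (i k) u * z (i ((finRotate (n + 1)).symm k)) u),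
      ← Equiv.prod_comp (finRotate (n + 1))]
    refine Finset.prod_congr rfl fun k _ => ?_
    simp only [Equiv.symm_apply_apply, Matrix.transpose_apply, Matrix.of_apply]
    rw [intervalIntegral.integral_of_le zero_le_one, integral_Icc_eq_integral_Ioc]
  · intro i _
    refine ContinuousOn.integrableOn_compact isCompact_Icc (Continuous.continuousOn ?_)
    fun_prop


/-! ### Generating functions of sums of squares of Gaussians -/

section

lemma mgf_sq_gaussianReal (v : NNReal) {t : ℝ} (ht : 0 < 1 - 2 * t * v) :
    mgf (fun x : ℝ => x ^ 2) (gaussianReal 0 v) t = (Real.sqrt (1 - 2 * t * v))⁻¹ := by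
  unfold mgf
  rcases eq_or_ne v 0 with rfl | hv
  · simp
  have hv' : (0 : ℝ) < v := by positivity
  rw [integral_gaussianReal_eq_integral_smul hv]
  have e : ∀ x : ℝ, gaussianPDFReal 0 v x • Real.exp (t * x ^ 2) =
      (Real.sqrt (2 * Real.pi * v))⁻¹ * Real.exp (-((1 - 2 * t * v) / (2 * v)) * x ^ 2) := by
    intro x
    rw [gaussianPDFReal, smul_eq_mul, mul_assoc, ← Real.exp_add]
    congr 2
    field_simp
    ring
  simp_rw [e]
  rw [integral_const_mul, integral_gaussian, ← Real.sqrt_inv, ← Real.sqrt_inv, ← Real.sqrt_mul]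
  · congr 1
    have := Real.pi_pos
    field_simp
  · positivity

variable {Ω : Type*} [MeasurableSpace Ω] {P : Measure Ω}

/-- The moment generating function of a sum of squares of independent centred Gaussians. -/
lemma mgf_sum_sq_gaussian [IsProbabilityMeasure P] {ι : Type*} [Fintype ι] {η : ι → Ω → ℝ}
    {d : ι → NNReal} (hm : ∀ i, AEMeasurable (η i) P) (hind : iIndepFun η P)
    (hη : ∀ i, P.map (η i) = gaussianReal 0 (d i)) {t : ℝ} (ht : ∀ i, 0 < 1 - 2 * t * d i) :
    mgf (fun ω => ∑ i, η i ω ^ 2) P t = ∏ i, (Real.sqrt (1 - 2 * t * d i))⁻¹ := by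
  have h1 : ∀ i, mgf (fun x : ℝ => x ^ 2) (gaussianReal 0 (d i)) t =
      ∫ ω, Real.exp (t * η i ω ^ 2) ∂P := by
    intro i
    rw [← hη i, mgf_map (hm i) (by fun_prop)]
    rfl
  simp_rw [← mgf_sq_gaussianReal _ (ht _), h1]
  have hcomp : iIndepFun (fun i => (fun x : ℝ => Real.exp (t * x ^ 2)) ∘ η i) P :=
    hind.comp _ fun i => by fun_prop
  have := hcomp.integral_fun_prod_eq_prod_integral (𝕜 := ℝ)
    (fun i => by
      have := hm i
      exact (AEMeasurable.aestronglyMeasurable (by fun_prop)))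
  simp only [Function.comp_apply] at this
  rw [← this, mgf]
  simp_rw [Finset.mul_sum, Real.exp_sum]

/-- The cumulant generating function of `∑ dᵢ ξᵢ² - m`, for independent standard Gaussians `ξᵢ`. -/
def chaosCgf {ι : Type*} [Fintype ι] (d : ι → ℝ) (m t : ℝ) : ℝ :=
  ∑ i, -(Real.log (1 - 2 * t * d i) / 2) - t * m

lemma eventually_pos {ι : Type*} [Fintype ι] (d : ι → ℝ) :
    ∀ᶠ t in 𝓝 (0 : ℝ), ∀ i, 0 < 1 - 2 * t * d i := by
  rw [eventually_all]
  intro i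
  have : ContinuousAt (fun t : ℝ => 1 - 2 * t * d i) 0 := by fun_prop
  exact this.eventually (lt_mem_nhds (by simp))

/-- Equality is claimed on a neighbourhood of 0, not just at 0, so that the induction can
differentiate it. -/
lemma iteratedDeriv_chaosCgf {ι : Type*} [Fintype ι] (d : ι → ℝ) (m : ℝ) (n : ℕ) :
    iteratedDeriv (n + 1) (chaosCgf d m) =ᶠ[𝓝 0] fun t =>
      ∑ i, (2 * d i) ^ (n + 1) * n.factorial / 2 / (1 - 2 * t * d i) ^ (n + 1) -
        if n = 0 then m else 0 := by
  have hlin : ∀ (i : ι) (t : ℝ), HasDerivAt (fun t : ℝ => 1 - 2 * t * d i) (-(2 * d i)) t := by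
    intro i t
    have := (((hasDerivAt_id t).const_mul 2).mul_const (d i)).const_sub 1
    simpa using this
  induction n with
  | zero =>
    filter_upwards [eventually_pos d] with t ht
    rw [iteratedDeriv_one]
    refine HasDerivAt.deriv ?_
    have h := (HasDerivAt.fun_sum (u := Finset.univ) fun i _ =>
      (((hlin i t).log (ht i).ne').div_const 2).neg).sub ((hasDerivAt_id t).mul_const m)
    convert! h using 1
    simp only [if_true, one_mul]
    congr 1
    refine Finset.sum_congr rfl fun i _ => ?_
    have := (ht i).ne'
    simp
    field_simp
  | succ n ih =>
    filter_upwards [eventually_pos d, ih.eventuallyEq_nhds] with t ht hih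
    rw [iteratedDeriv_succ, hih.deriv_eq]
    refine HasDerivAt.deriv ?_
    have h := (HasDerivAt.fun_sum (u := Finset.univ) fun i _ =>
      (((hlin i t).pow (n + 1)).inv (pow_ne_zero _ (ht i).ne')).const_mul
        ((2 * d i) ^ (n + 1) * n.factorial / 2)).sub_const (if n = 0 then m else 0)
    convert! h using 1
    simp only [Nat.add_eq_zero_iff, one_ne_zero, and_false, if_false, sub_zero]
    refine Finset.sum_congr rfl fun i _ => ?_
    have := (ht i).ne'
    simp only [Pi.pow_apply, Nat.factorial_succ]
    generalize 1 - 2 * t * d i = x at this ⊢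
    rw [Nat.add_sub_cancel]
    push_cast
    field_simp
    ring

lemma iteratedDeriv_chaosCgf_zero {ι : Type*} [Fintype ι] (d : ι → ℝ) (m : ℝ) (n : ℕ) :
    iteratedDeriv (n + 1) (chaosCgf d m) 0 =
      2 ^ n * n.factorial * ∑ i, d i ^ (n + 1) - if n = 0 then m else 0 := by
  rw [(iteratedDeriv_chaosCgf d m n).eq_of_nhds, Finset.mul_sum]
  congr 1
  refine Finset.sum_congr rfl fun i _ => ?_
  simp
  ring

end

/-! ### Diagonalisation of Gaussian quadratic forms and cumulants -/

section

lemma trace_mul_pow_comm {ι : Type*} [Fintype ι] [DecidableEq ι] (X Y : Matrix ι ι ℝ) (p : ℕ) :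
    ((X * Y) ^ p).trace = ((Y * X) ^ p).trace := by
  rcases p with _ | n
  · simp
  · rw [pow_succ, ← mul_assoc, mul_pow_mul, mul_assoc, Matrix.trace_mul_comm, pow_succ, mul_assoc]

open Matrix in
open scoped MatrixOrder Matrix.Norms.L2Operator in
/-- A positive semidefinite form and a symmetric form can be reduced simultaneously. -/
lemma exists_simultaneous_diagonalization {ι : Type*} [Fintype ι] [DecidableEq ι]
    {G S : Matrix ι ι ℝ} (hG : G.PosSemidef) (hS : S.IsHermitian) :
    ∃ (W : Matrix ι ι ℝ) (d : ι → ℝ), Wᵀ * W = G ∧ W * S * Wᵀ = diagonal d := by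
  obtain ⟨B, rfl⟩ := CStarAlgebra.nonneg_iff_eq_star_mul_self.mp hG.nonneg
  have hA : (B * S * Bᵀ).IsHermitian := by
    have := isHermitian_mul_mul_conjTranspose B hS
    simpa [conjTranspose_eq_transpose_of_trivial] using this
  set U : Matrix ι ι ℝ := (hA.eigenvectorUnitary : Matrix ι ι ℝ) with hU
  have hUU : U * Uᵀ = 1 := by
    have := Unitary.coe_mul_star_self hA.eigenvectorUnitary
    rwa [Unitary.coe_star, star_eq_conjTranspose, conjTranspose_eq_transpose_of_trivial] at this
  have hd := hA.conjStarAlgAut_star_eigenvectorUnitary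
  rw [Unitary.conjStarAlgAut_star_apply, star_eq_conjTranspose,
    conjTranspose_eq_transpose_of_trivial, ← hU] at hd
  -- With $G=B^{T}B$ and $U$ orthogonal diagonalising $BSB^{T}$, take $W=U^{T}B$. Neither matrix has
  -- to be invertible.
  refine ⟨Uᵀ * B, hA.eigenvalues, ?_, ?_⟩
  · rw [transpose_mul, transpose_transpose, star_eq_conjTranspose,
      conjTranspose_eq_transpose_of_trivial]
    calc Bᵀ * U * (Uᵀ * B) = Bᵀ * (U * Uᵀ) * B := by simp only [mul_assoc]
      _ = _ := by rw [hUU, mul_one]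
  · rw [transpose_mul, transpose_transpose]
    calc Uᵀ * B * S * (Bᵀ * U) = Uᵀ * (B * S * Bᵀ) * U := by simp only [mul_assoc]
      _ = _ := by rw [hd]; rfl

variable {Ω : Type*} [MeasurableSpace Ω] {P : Measure Ω}

/-- The matrix of second moments of a random vector. -/
def momentMatrix {ι : Type*} (P : Measure Ω) (r : ι → Ω → ℝ) : Matrix ι ι ℝ :=
  Matrix.of fun i j => ∫ ω, r i ω * r j ω ∂P

/-- The quadratic form with matrix `G` in a random vector. -/
def quadForm {ι : Type*} [Fintype ι] (r : ι → Ω → ℝ) (G : Matrix ι ι ℝ) (ω : Ω) : ℝ :=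
  ∑ i, ∑ j, G i j * (r i ω * r j ω)

lemma integral_sum_mul_sum {ι : Type*} [Fintype ι] {r : ι → Ω → ℝ}
    (hr : ∀ i, MemLp (r i) 2 P) (x y : ι → ℝ) :
    ∫ ω, (∑ i, x i * r i ω) * (∑ j, y j * r j ω) ∂P =
      ∑ i, ∑ j, x i * momentMatrix P r i j * y j := by
  have hInt : ∀ i j, Integrable (fun ω => r i ω * r j ω) P := fun i j =>
    (hr i).integrable_mul (hr j)
  have e : ∀ ω, (∑ i, x i * r i ω) * (∑ j, y j * r j ω) =
      ∑ i, ∑ j, x i * y j * (r i ω * r j ω) := by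
    intro ω
    rw [Finset.sum_mul_sum]
    exact Finset.sum_congr rfl fun i _ => Finset.sum_congr rfl fun j _ => by ring
  simp_rw [e]
  rw [integral_finsetSum _ fun i _ => integrable_finsetSum _ fun j _ => (hInt i j).const_mul _]
  refine Finset.sum_congr rfl fun i _ => ?_
  rw [integral_finsetSum _ fun j _ => (hInt i j).const_mul _]
  refine Finset.sum_congr rfl fun j _ => ?_
  rw [integral_const_mul]
  simp only [momentMatrix, Matrix.of_apply]
  ring

open Matrix in
/-- A positive semidefinite quadratic form in a centred Gaussian vector is a sum of squares of
independent centred Gaussian variables. -/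
lemma exists_quadForm_eq_sum_sq {ι : Type*} [Fintype ι] [DecidableEq ι] [IsProbabilityMeasure P]
    {r : ι → Ω → ℝ} (hr : HasGaussianLaw (fun ω i => r i ω) P) (h0 : ∀ i, ∫ ω, r i ω ∂P = 0)
    {G : Matrix ι ι ℝ} (hG : G.PosSemidef) :
    ∃ (η : ι → Ω → ℝ) (d : ι → NNReal), (∀ i, AEMeasurable (η i) P) ∧ iIndepFun η P ∧
      (∀ i, P.map (η i) = gaussianReal 0 (d i)) ∧
      (∀ ω, quadForm r G ω = ∑ i, η i ω ^ 2) ∧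
      ∀ p : ℕ, ∑ i, (d i : ℝ) ^ p = ((G * momentMatrix P r) ^ p).trace := by
  have hS : (momentMatrix P r).IsHermitian := by
    ext i j
    simp [momentMatrix, mul_comm]
  have hL : ∀ i, MemLp (r i) 2 P := fun i => (hr.eval i).memLp_two
  obtain ⟨W, d, hW, hd⟩ := exists_simultaneous_diagonalization hG hS
  set η : ι → Ω → ℝ := fun i ω => ∑ j, W i j * r j ω with hη
  have hgauss : HasGaussianLaw (fun ω i => η i ω) P := by
    have := hr.map (LinearMap.toContinuousLinearMap (Matrix.toLin' W))
    convert! this using 1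
  have hηm : ∀ i, ∫ ω, η i ω ∂P = 0 := by
    intro i
    simp only [hη]
    rw [integral_finsetSum _ fun j _ => ((hr.eval j).integrable).const_mul _]
    simp [integral_const_mul, h0]
  have hcov : ∀ i j, ∫ ω, η i ω * η j ω ∂P = diagonal d i j := by
    intro i j
    simp only [hη]
    rw [integral_sum_mul_sum hL, ← hd, Matrix.mul_apply]
    simp only [Matrix.mul_apply, Finset.sum_mul, transpose_apply]
    exact Finset.sum_comm
  have hηL : ∀ i, MemLp (η i) 2 P := fun i => (hgauss.eval i).memLp_two
  have hvar : ∀ i, variance (η i) P = d i := by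
    intro i
    rw [variance_of_integral_eq_zero (hgauss.eval i).aemeasurable (hηm i)]
    simpa [sq] using hcov i i
  have hd0 : ∀ i, 0 ≤ d i := fun i => hvar i ▸ variance_nonneg _ _
  refine ⟨η, fun i => (d i).toNNReal, fun i => (hgauss.eval i).aemeasurable, ?_, ?_, ?_, ?_⟩
  · refine hgauss.iIndepFun_of_covariance_eq_zero fun i j hij => ?_
    rw [covariance_eq_sub (hηL i) (hηL j)]
    simp only [Pi.mul_apply, hcov, hηm, diagonal_apply_ne _ hij]
    simp
  · intro i
    rw [(hgauss.eval i).map_eq_gaussianReal, hηm, hvar]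
  · intro ω
    have h1 : ∑ i, η i ω ^ 2 = (W *ᵥ fun i => r i ω) ⬝ᵥ (W *ᵥ fun i => r i ω) := by
      simp only [hη, dotProduct, Matrix.mulVec, sq]
    rw [h1, Matrix.dotProduct_mulVec, Matrix.vecMul_mulVec, hW]
    simp only [quadForm, dotProduct, Matrix.vecMul, Finset.sum_mul]
    rw [Finset.sum_comm]
    refine Finset.sum_congr rfl fun i _ => Finset.sum_congr rfl fun j _ => ?_
    ring
  · intro p
    rw [← hW, Matrix.mul_assoc, trace_mul_pow_comm, hd, Matrix.diagonal_pow, Matrix.trace_diagonal]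
    simp [hd0]

/-- The cumulant generating function of a centred Gaussian quadratic form near the origin. -/
lemma cgf_sum_sq_gaussian [IsProbabilityMeasure P] {ι : Type*} [Fintype ι] {η : ι → Ω → ℝ}
    {d : ι → NNReal} (hm : ∀ i, AEMeasurable (η i) P) (hind : iIndepFun η P)
    (hη : ∀ i, P.map (η i) = gaussianReal 0 (d i)) :
    (0 : ℝ) ∈ interior (integrableExpSet (fun ω => ∑ i, η i ω ^ 2) P) ∧
      cgf (fun ω => ∑ i, η i ω ^ 2) P =ᶠ[𝓝 0] chaosCgf (fun i => (d i : ℝ)) 0 := by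
  constructor
  · rw [mem_interior_iff_mem_nhds]
    filter_upwards [eventually_pos fun i => (d i : ℝ)] with t ht
    -- The integral of a non-integrable function is 0 by convention, so a positive moment generating
    -- function already gives integrability.
    refine mgf_pos_iff.mp ?_
    rw [mgf_sum_sq_gaussian hm hind hη ht]
    exact Finset.prod_pos fun i _ => inv_pos.mpr (Real.sqrt_pos.mpr (ht i))
  · filter_upwards [eventually_pos fun i => (d i : ℝ)] with t ht
    rw [cgf, mgf_sum_sq_gaussian hm hind hη ht, Real.log_prod, chaosCgf, mul_zero, sub_zero]
    · refine Finset.sum_congr rfl fun i _ => ?_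
      rw [Real.log_inv, Real.log_sqrt (ht i).le]
    · exact fun i _ => (inv_pos.mpr (Real.sqrt_pos.mpr (ht i))).ne'

lemma integral_variance_sum_sq_gaussian [IsProbabilityMeasure P] {ι : Type*} [Fintype ι]
    {η : ι → Ω → ℝ}
    {d : ι → NNReal} (hm : ∀ i, AEMeasurable (η i) P) (hind : iIndepFun η P)
    (hη : ∀ i, P.map (η i) = gaussianReal 0 (d i)) :
    ∫ ω, ∑ i, η i ω ^ 2 ∂P = ∑ i, (d i : ℝ) ∧
      variance (fun ω => ∑ i, η i ω ^ 2) P = 2 * ∑ i, (d i : ℝ) ^ 2 := by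
  obtain ⟨h1, h2⟩ := cgf_sum_sq_gaussian hm hind hη
  have e1 : ∫ ω, ∑ i, η i ω ^ 2 ∂P = ∑ i, (d i : ℝ) := by
    have := deriv_cgf_zero h1
    rw [← iteratedDeriv_one, (h2.iteratedDeriv 1).eq_of_nhds,
      iteratedDeriv_chaosCgf_zero _ _ 0] at this
    simpa using this.symm
  refine ⟨e1, ?_⟩
  have h3 := iteratedDeriv_two_cgf_eq_integral h1
  rw [(h2.iteratedDeriv 2).eq_of_nhds, iteratedDeriv_chaosCgf_zero _ _ 1, deriv_cgf_zero h1] at h3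
  rw [variance_eq_integral (by fun_prop)]
  simpa using h3.symm

/-- Cumulants of a standardised sum of squares of independent centred Gaussian variables. -/
lemma cumulant_standardized_sum_sq [IsProbabilityMeasure P] {ι : Type*} [Fintype ι]
    {η : ι → Ω → ℝ}
    {d : ι → NNReal} (hm : ∀ i, AEMeasurable (η i) P) (hind : iIndepFun η P)
    (hη : ∀ i, P.map (η i) = gaussianReal 0 (d i)) (m s : ℝ) :
    (0 : ℝ) ∈ interior (integrableExpSet id (P.map fun ω => (∑ i, η i ω ^ 2 - m) / s)) ∧
      ∀ n, cumulant (n + 1) (P.map fun ω => (∑ i, η i ω ^ 2 - m) / s) =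
        2 ^ n * n.factorial * ∑ i, ((d i : ℝ) / s) ^ (n + 1) - if n = 0 then m / s else 0 := by
  obtain ⟨h1, h2⟩ := cgf_sum_sq_gaussian hm hind hη
  have hF : AEMeasurable (fun ω => (∑ i, η i ω ^ 2 - m) / s) P := by fun_prop
  have hmgf : mgf id (P.map fun ω => (∑ i, η i ω ^ 2 - m) / s) =
      fun t => mgf (fun ω => ∑ i, η i ω ^ 2) P (t / s) * Real.exp (-(t * (m / s))) := by
    rw [mgf_id_map hF]
    ext t
    simp only [mgf]
    rw [← integral_mul_const]
    refine integral_congr_ae (Eventually.of_forall fun ω => ?_)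
    simp only
    rw [← Real.exp_add]
    congr 1
    ring
  have hlim : Tendsto (fun t : ℝ => t / s) (𝓝 0) (𝓝 0) := by
    have : Continuous fun t : ℝ => t / s := by fun_prop
    simpa using this.tendsto 0
  have hprob : IsProbabilityMeasure (P.map fun ω => (∑ i, η i ω ^ 2 - m) / s) :=
    Measure.isProbabilityMeasure_map hF
  have hInt : ∀ᶠ t in 𝓝 (0 : ℝ), t / s ∈ integrableExpSet (fun ω => ∑ i, η i ω ^ 2) P :=
    hlim.eventually (mem_interior_iff_mem_nhds.mp h1)
  have hcgf : cgf id (P.map fun ω => (∑ i, η i ω ^ 2 - m) / s) =ᶠ[𝓝 0]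
      chaosCgf (fun i => (d i : ℝ) / s) (m / s) := by
    filter_upwards [hInt, hlim.eventually h2] with t ht ht2
    rw [cgf, hmgf, Real.log_mul (mgf_pos ht).ne' (Real.exp_pos _).ne', Real.log_exp, ← cgf, ht2]
    simp only [chaosCgf, mul_zero, sub_zero, ← sub_eq_add_neg]
    congr 1
    refine Finset.sum_congr rfl fun i _ => ?_
    congr 4
    ring
  constructor
  · rw [mem_interior_iff_mem_nhds]
    filter_upwards [hInt] with t ht
    refine mgf_pos_iff.mp ?_
    rw [hmgf]
    exact mul_pos (mgf_pos ht) (Real.exp_pos _)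
  · intro n
    rw [cumulant, (hcgf.iteratedDeriv (n + 1)).eq_of_nhds, iteratedDeriv_chaosCgf_zero]

/-- The cumulant generating function is a quadratic polynomial, including in the degenerate case
$v=0$. -/
lemma cumulant_four_gaussianReal (b : ℝ) (v : NNReal) : cumulant 4 (gaussianReal b v) = 0 := by
  have h : cgf id (gaussianReal b v) = fun t => b * t + v * t ^ 2 / 2 := by
    ext t
    exact cgf_gaussianReal (by simp) t
  have d1 : deriv (fun t : ℝ => b * t + v * t ^ 2 / 2) = fun t => b + v * t := by
    ext t
    have := ((hasDerivAt_id t).const_mul b).add ((((hasDerivAt_id t).pow 2).const_mul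
      (v : ℝ)).div_const 2)
    refine HasDerivAt.deriv ?_
    convert! this using 1
    simp
    ring
  have d2 : deriv (fun t : ℝ => b + v * t) = fun _ => (v : ℝ) := by
    ext t
    simp
  rw [cumulant, h, iteratedDeriv_succ', iteratedDeriv_succ', d1, d2]
  simp [iteratedDeriv_succ']

end

/-! ### Convergence of the quadratic forms; the normalising integral -/

section

/-- Convergence of normalised products of increments to the integral of the product of the
derivatives. -/
lemma tendsto_sum_increment_mul {f g f' g' : ℝ → ℝ} (hf : ∀ x, HasDerivAt f (f' x) x)
    (hg : ∀ x, HasDerivAt g (g' x) x) (hf' : Continuous f') (hg' : Continuous g') :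
    Tendsto (fun N : ℕ => (N : ℝ) * ∑ i ∈ Finset.Icc 1 N,
      (f (((i : ℝ) + 1) / N) - f ((i : ℝ) / N)) * (g (((i : ℝ) + 1) / N) - g ((i : ℝ) / N)))
      atTop (𝓝 (∫ u in (0 : ℝ)..1, f' u * g' u)) := by
  have hcont : Continuous fun u => f' u * g' u := hf'.mul hg'
  have hii : ∀ a b : ℝ, IntervalIntegrable (fun u => f' u * g' u) volume a b :=
    fun a b => hcont.intervalIntegrable a b
  set J : ℝ → ℝ := fun b => ∫ u in (0 : ℝ)..b, f' u * g' u with hJ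
  have hJc : Continuous J := intervalIntegral.continuous_primitive hii 0
  have hinv : Tendsto (fun N : ℕ => (N : ℝ)⁻¹) atTop (𝓝 0) := tendsto_inv_atTop_nhds_zero_nat
  -- The indices run from 1 to $N$, so the increments cover $[1/N, 1+1/N]$ rather than $[0,1]$.
  have hlim : Tendsto (fun N : ℕ => J (1 + (N : ℝ)⁻¹) - J ((N : ℝ)⁻¹)) atTop
      (𝓝 (∫ u in (0 : ℝ)..1, f' u * g' u)) := by
    have h1 := (hJc.tendsto (1 + 0)).comp (hinv.const_add 1)
    have h2 := (hJc.tendsto 0).comp hinv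
    simpa [hJ] using h1.sub h2
  have hdiff : Tendsto (fun N : ℕ => (N : ℝ) * ∑ i ∈ Finset.Icc 1 N,
      (f (((i : ℝ) + 1) / N) - f ((i : ℝ) / N)) * (g (((i : ℝ) + 1) / N) - g ((i : ℝ) / N)) -
      (J (1 + (N : ℝ)⁻¹) - J ((N : ℝ)⁻¹))) atTop (𝓝 0) := by
    -- Two variables are needed since the mean value theorem gives different points for `f` and `g`;
    -- the box $[0,2]^2$ contains all of them.
    have huc := (isCompact_Icc (a := (0 : ℝ × ℝ)) (b := 2)).uniformContinuousOn_of_continuous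
      (f := fun p : ℝ × ℝ => f' p.1 * g' p.2) (by fun_prop)
    rw [Metric.uniformContinuousOn_iff] at huc
    rw [Metric.tendsto_nhds]
    intro ε hε
    obtain ⟨δ, hδ, hd⟩ := huc (ε / 2) (by positivity)
    filter_upwards [hinv.eventually (gt_mem_nhds hδ), eventually_gt_atTop 0] with N hN hN0
    have hNpos : (0 : ℝ) < N := by exact_mod_cast hN0
    have hsum : J (1 + (N : ℝ)⁻¹) - J ((N : ℝ)⁻¹) = ∑ i ∈ Finset.Icc 1 N,
        ∫ u in ((i : ℝ) / N)..(((i : ℝ) + 1) / N), f' u * g' u := by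
      have h := intervalIntegral.sum_integral_adjacent_intervals_Ico
        (μ := volume) (f := fun u => f' u * g' u)
        (a := fun k : ℕ => (k : ℝ) / N) (m := 1) (n := N + 1) (by omega) (fun k _ => hii _ _)
      rw [intervalIntegral.integral_interval_sub_left (hii _ _) (hii _ _)]
      rw [show Finset.Icc 1 N = Finset.Ico 1 (N + 1) by ext; simp]
      push_cast at h
      rw [h]
      congr 1 <;> field_simp
    rw [dist_zero_right, hsum, Finset.mul_sum, ← Finset.sum_sub_distrib]
    have hterm : ∀ i ∈ Finset.Icc 1 N,
        ‖(N : ℝ) * ((f (((i : ℝ) + 1) / N) - f ((i : ℝ) / N)) *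
          (g (((i : ℝ) + 1) / N) - g ((i : ℝ) / N))) -
          ∫ u in ((i : ℝ) / N)..(((i : ℝ) + 1) / N), f' u * g' u‖ ≤ ε / 2 * (N : ℝ)⁻¹ := by
      intro i hi
      rw [Finset.mem_Icc] at hi
      have hiN : (i : ℝ) ≤ N := by exact_mod_cast hi.2
      have h1N : (1 : ℝ) ≤ N := by exact_mod_cast hN0
      have hlen : ((i : ℝ) + 1) / N - (i : ℝ) / N = (N : ℝ)⁻¹ := by rw [← sub_div]; simp
      have hlt : (i : ℝ) / N < ((i : ℝ) + 1) / N := by gcongr; linarith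
      have hlo : 0 ≤ (i : ℝ) / N := by positivity
      have hhi : ((i : ℝ) + 1) / N ≤ 2 := by rw [div_le_iff₀ hNpos]; linarith
      obtain ⟨ξ, hξ, eξ⟩ := exists_hasDerivAt_eq_slope f f' hlt
        (fun x _ => (hf x).continuousAt.continuousWithinAt) (fun x _ => hf x)
      obtain ⟨ζ, hζ, eζ⟩ := exists_hasDerivAt_eq_slope g g' hlt
        (fun x _ => (hg x).continuousAt.continuousWithinAt) (fun x _ => hg x)
      rw [hlen, eq_div_iff (by positivity)] at eξ eζ
      have e : (N : ℝ) * ((f (((i : ℝ) + 1) / N) - f ((i : ℝ) / N)) *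
          (g (((i : ℝ) + 1) / N) - g ((i : ℝ) / N))) =
          ∫ _u in ((i : ℝ) / N)..(((i : ℝ) + 1) / N), f' ξ * g' ζ := by
        rw [intervalIntegral.integral_const, hlen, ← eξ, ← eζ, smul_eq_mul]
        field_simp
      rw [e, ← intervalIntegral.integral_sub (by simp) (hii _ _)]
      have hb := intervalIntegral.norm_integral_le_of_norm_le_const
        (a := (i : ℝ) / N) (b := ((i : ℝ) + 1) / N) (C := ε / 2)
        (f := fun u => f' ξ * g' ζ - f' u * g' u) (fun u hu => by
          rw [Set.uIoc_of_le hlt.le] at hu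
          have hmem : ∀ s t : ℝ, s ∈ Set.Icc ((i : ℝ) / N) (((i : ℝ) + 1) / N) →
              t ∈ Set.Icc ((i : ℝ) / N) (((i : ℝ) + 1) / N) →
              (s, t) ∈ Set.Icc (0 : ℝ × ℝ) 2 := fun s t hs ht =>
            ⟨⟨hlo.trans hs.1, hlo.trans ht.1⟩, ⟨hs.2.trans hhi, ht.2.trans hhi⟩⟩
          have hu' := Set.Ioc_subset_Icc_self hu
          have hξ' := Set.Ioo_subset_Icc_self hξ
          have hζ' := Set.Ioo_subset_Icc_self hζ
          have := hd (ξ, ζ) (hmem _ _ hξ' hζ') (u, u) (hmem _ _ hu' hu') (by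
            rw [Prod.dist_eq, max_lt_iff]
            exact ⟨((Real.dist_le_of_mem_Icc hξ' hu').trans_eq hlen).trans_lt hN,
              ((Real.dist_le_of_mem_Icc hζ' hu').trans_eq hlen).trans_lt hN⟩)
          exact (Real.dist_eq _ _ ▸ this).le)
      rwa [hlen, abs_of_pos (by positivity)] at hb
    calc _ ≤ ∑ i ∈ Finset.Icc 1 N, ε / 2 * (N : ℝ)⁻¹ := norm_sum_le_of_le _ hterm
      _ = ε / 2 := by
        rw [Finset.sum_const, Nat.card_Icc, nsmul_eq_mul]
        simp
        field_simp
      _ < ε := by linarith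
  simpa using hdiff.add hlim

variable {Ω : Type*} [MeasurableSpace Ω] {P : Measure Ω}

lemma tendsto_quadForm {Ω ι : Type*} [Fintype ι] (r : ι → Ω → ℝ) {G : ℕ → Matrix ι ι ℝ}
    {G' : Matrix ι ι ℝ} (hG : ∀ i j, Tendsto (fun n => G n i j) atTop (𝓝 (G' i j))) (ω : Ω) :
    Tendsto (fun n => quadForm r (G n) ω) atTop (𝓝 (quadForm r G' ω)) :=
  tendsto_finsetSum _ fun i _ => tendsto_finsetSum _ fun j _ => (hG i j).mul_const _

lemma tendsto_integral_quadForm {ι : Type*} [Fintype ι] {r : ι → Ω → ℝ}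
    (hr : ∀ i j, Integrable (fun ω => r i ω * r j ω) P) {G : ℕ → Matrix ι ι ℝ}
    {G' : Matrix ι ι ℝ} (hG : ∀ i j, Tendsto (fun n => G n i j) atTop (𝓝 (G' i j))) :
    Tendsto (fun n => ∫ ω, quadForm r (G n) ω ∂P) atTop (𝓝 (∫ ω, quadForm r G' ω ∂P)) := by
  have e : ∀ A : Matrix ι ι ℝ, ∫ ω, quadForm r A ω ∂P =
      ∑ i, ∑ j, A i j * ∫ ω, r i ω * r j ω ∂P := by
    intro A
    refine (integral_finsetSum (f := fun i ω => ∑ j, A i j * (r i ω * r j ω)) _ fun i _ =>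
      integrable_finsetSum _ fun j _ => (hr i j).const_mul _).trans ?_
    refine Finset.sum_congr rfl fun i _ => ?_
    refine (integral_finsetSum (f := fun j ω => A i j * (r i ω * r j ω)) _ fun j _ =>
      (hr i j).const_mul _).trans ?_
    exact Finset.sum_congr rfl fun j _ => integral_const_mul _ _
  simp_rw [e]
  exact tendsto_finsetSum _ fun i _ => tendsto_finsetSum _ fun j _ => (hG i j).mul_const _

/-- The variance is a quadratic polynomial in the entries of the matrix, with fixed covariances as
coefficients. -/
lemma tendsto_variance_quadForm [IsProbabilityMeasure P] {ι : Type*} [Fintype ι] {r : ι → Ω → ℝ}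
    (hr : ∀ i j, MemLp (fun ω => r i ω * r j ω) 2 P) {G : ℕ → Matrix ι ι ℝ}
    {G' : Matrix ι ι ℝ} (hG : ∀ i j, Tendsto (fun n => G n i j) atTop (𝓝 (G' i j))) :
    Tendsto (fun n => variance (quadForm r (G n)) P) atTop (𝓝 (variance (quadForm r G') P)) := by
  have e : ∀ A : Matrix ι ι ℝ, variance (quadForm r A) P =
      ∑ p : ι × ι, ∑ q : ι × ι, A p.1 p.2 * (A q.1 q.2 *
        cov[fun ω => r p.1 ω * r p.2 ω, fun ω => r q.1 ω * r q.2 ω; P]) := by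
    intro A
    have hA : quadForm r A = fun ω => ∑ p : ι × ι, A p.1 p.2 * (r p.1 ω * r p.2 ω) := by
      ext ω
      rw [Fintype.sum_prod_type]
      rfl
    have hL : ∀ p : ι × ι, MemLp (fun ω => A p.1 p.2 * (r p.1 ω * r p.2 ω)) 2 P :=
      fun p => (hr p.1 p.2).const_mul _
    rw [hA, ← covariance_self (memLp_finsetSum _ fun p _ => hL p).aemeasurable,
      covariance_fun_sum_fun_sum hL hL]
    simp_rw [covariance_const_mul_left, covariance_const_mul_right]
  simp_rw [e]
  exact tendsto_finsetSum _ fun p _ => tendsto_finsetSum _ fun q _ =>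
    (hG p.1 p.2).mul ((hG q.1 q.2).mul_const _)

lemma kernelSq_eq_cyclicIntegral (l : ℕ) : kernelSq l = cyclicIntegral l 2 := by
  have hk := continuous_kernel l
  have h := (volume_preserving_finTwoArrow ℝ).setIntegral_preimage_emb
    (MeasurableEquiv.measurableEmbedding _)
    (fun p : ℝ × ℝ => kernel l |p.1 - p.2| ^ 2) (Set.Icc 0 1 ×ˢ Set.Icc 0 1)
  have hpre : (MeasurableEquiv.finTwoArrow (α := ℝ)) ⁻¹' (Set.Icc 0 1 ×ˢ Set.Icc 0 1) =
      Set.Icc (0 : Fin 2 → ℝ) 1 := by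
    ext x
    simp [MeasurableEquiv.finTwoArrow, Pi.le_def, Fin.forall_fin_two]
  rw [hpre] at h
  have hInt : IntegrableOn (fun p : ℝ × ℝ => kernel l |p.1 - p.2| ^ 2)
      (Set.Icc 0 1 ×ˢ Set.Icc 0 1) (volume.prod volume) :=
    ContinuousOn.integrableOn_compact (isCompact_Icc.prod isCompact_Icc)
      (Continuous.continuousOn (by fun_prop))
  rw [Measure.volume_eq_prod, setIntegral_prod _ hInt] at h
  rw [kernelSq, intervalIntegral.integral_of_le zero_le_one, ← integral_Icc_eq_integral_Ioc]
  have hin : ∀ x : ℝ, ∫ y in (0 : ℝ)..1, kernel l |x - y| ^ 2 =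
      ∫ y in Set.Icc (0 : ℝ) 1, kernel l |x - y| ^ 2 := fun x => by
    rw [intervalIntegral.integral_of_le zero_le_one, ← integral_Icc_eq_integral_Ioc]
  simp_rw [hin]
  rw [← h, cyclicIntegral]
  refine integral_congr_ae (Eventually.of_forall fun x => ?_)
  simp only [Fin.prod_univ_two]
  have e0 : finRotate 2 0 = 1 := rfl
  have e1 : finRotate 2 1 = 0 := rfl
  rw [e0, e1, abs_sub_comm (x 1) (x 0), ← sq]
  rfl

/-- $g_\ell$ is continuous and $g_\ell(0)=\ell(\ell+1)/2>0$, so the integrand is positive on the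
diagonal. -/
lemma kernelSq_pos {l : ℕ} (hl : 1 ≤ l) : 0 < kernelSq l := by
  have hk := continuous_kernel l
  have hc : Continuous fun x : ℝ => ∫ y in (0 : ℝ)..1, kernel l |x - y| ^ 2 :=
    intervalIntegral.continuous_parametric_intervalIntegral_of_continuous' (by fun_prop) 0 1
  have h0 : 0 < kernel l 0 := by
    rw [kernel_zero]
    have : (0 : ℝ) < l := by exact_mod_cast hl
    positivity
  refine intervalIntegral.intervalIntegral_pos_of_pos_on (hc.intervalIntegrable 0 1)
    (fun x hx => ?_) one_pos
  refine intervalIntegral.integral_pos one_pos (Continuous.continuousOn (by fun_prop))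
    (fun y _ => sq_nonneg _) ⟨x, Set.Ioo_subset_Icc_self hx, ?_⟩
  simp only [sub_self, abs_zero]
  positivity

end

/-! ### The field on the meridian and its limiting quadratic variation -/

section

/-- The order `m` harmonic along the meridian, with polar angle `u π / 2`. -/
def profile (l : ℕ) (m : Orders l) (u : ℝ) : ℝ := meridianHarmonic l m (u * (Real.pi / 2))

lemma contDiff_profile (l : ℕ) (m : Orders l) : ContDiff ℝ 2 (profile l m) :=
  (contDiff_meridianHarmonic l m).comp (contDiff_id.mul contDiff_const)

lemma hasDerivAt_profile (l : ℕ) (m : Orders l) (u : ℝ) :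
    HasDerivAt (profile l m) (deriv (profile l m) u) u :=
  ((contDiff_profile l m).differentiable (by norm_num) u).hasDerivAt

lemma continuous_deriv_profile (l : ℕ) (m : Orders l) : Continuous (deriv (profile l m)) :=
  (contDiff_profile l m).continuous_deriv (by norm_num)

/-- The Gram matrix of the derivatives of the profiles on `[0, 1]`. -/
def gramMatrix (l : ℕ) : Matrix (Orders l) (Orders l) ℝ :=
  Matrix.of fun i j => ∫ u in (0 : ℝ)..1, deriv (profile l i) u * deriv (profile l j) u

open Matrix in
lemma posSemidef_gramMatrix (l : ℕ) : (gramMatrix l).PosSemidef := by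
  refine PosSemidef.of_dotProduct_mulVec_nonneg ?_ fun x => ?_
  · ext i j
    simp [gramMatrix, mul_comm]
  · have hc := continuous_deriv_profile l
    have e : star x ⬝ᵥ (gramMatrix l *ᵥ x) =
        ∫ u in (0 : ℝ)..1, (∑ i, x i * deriv (profile l i) u) ^ 2 := by
      simp_rw [sq, Finset.sum_mul_sum]
      rw [intervalIntegral.integral_finsetSum fun i _ =>
        Continuous.intervalIntegrable (by fun_prop) _ _]
      simp only [dotProduct, mulVec, Finset.mul_sum]
      refine Finset.sum_congr rfl fun i _ => ?_
      rw [intervalIntegral.integral_finsetSum fun j _ =>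
        Continuous.intervalIntegrable (by fun_prop) _ _]
      refine Finset.sum_congr rfl fun j _ => ?_
      rw [gramMatrix, of_apply, star_trivial, mul_comm (∫ _ in _.._, _) (x j), ← mul_assoc,
        ← intervalIntegral.integral_const_mul]
      congr 1
      ext u
      ring
    rw [e]
    exact intervalIntegral.integral_nonneg zero_le_one fun u _ => sq_nonneg _

variable {Ω : Type*} [MeasurableSpace Ω] {P : Measure Ω} {l : ℕ} {C : ℝ} {a : Orders l → Ω → ℂ}

/-- The real parts of the random coefficients. -/
def realCoeff (a : Orders l → Ω → ℂ) (m : Orders l) (ω : Ω) : ℝ := (a m ω).re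

lemma component_spherePoint {Ω : Type*} (a : Orders l → Ω → ℂ) (u : ℝ) (ω : Ω) :
    component l a (spherePoint 0 (u * (Real.pi / 2))) ω =
      ∑ m, profile l m u * realCoeff a m ω := by
  rw [component, componentC, Complex.re_sum]
  refine Finset.sum_congr rfl fun m _ => ?_
  rw [sphericalHarmonic_spherePoint_zero, Complex.re_mul_ofReal, mul_comm]
  rfl

/-- The matrix of the quadratic variation as a quadratic form, multiplied by `N`. -/
def incrementMatrix (l N : ℕ) : Matrix (Orders l) (Orders l) ℝ :=
  Matrix.of fun m n => (N : ℝ) * ∑ i ∈ Finset.Icc 1 N,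
    (profile l m (((i : ℝ) + 1) / N) - profile l m ((i : ℝ) / N)) *
      (profile l n (((i : ℝ) + 1) / N) - profile l n ((i : ℝ) / N))

lemma mul_quadVar {Ω : Type*} (a : Orders l → Ω → ℂ) (N : ℕ) (ω : Ω) :
    (N : ℝ) * quadVar l a N ω = quadForm (realCoeff a) (incrementMatrix l N) ω := by
  simp only [quadVar, component_spherePoint, quadForm, incrementMatrix, Matrix.of_apply]
  simp_rw [← Finset.sum_sub_distrib, ← sub_mul, sq, Finset.sum_mul_sum, Finset.mul_sum,
    Finset.sum_mul]
  rw [Finset.sum_comm]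
  refine Finset.sum_congr rfl fun m _ => ?_
  rw [Finset.sum_comm]
  refine Finset.sum_congr rfl fun n _ => Finset.sum_congr rfl fun i _ => ?_
  ring

lemma IsIsotropicCoeff.hasGaussianLaw_realCoeff (ha : IsIsotropicCoeff P l C a) :
    HasGaussianLaw (fun ω m => realCoeff a m ω) P :=
  ha.gaussian.map (ContinuousLinearMap.pi fun m => Complex.reCLM.comp (ContinuousLinearMap.proj m))

lemma IsIsotropicCoeff.integral_realCoeff (ha : IsIsotropicCoeff P l C a) (m : Orders l) :
    ∫ ω, realCoeff a m ω ∂P = 0 := by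
  have h := Complex.reCLM.integral_comp_comm (ha.gaussian.eval m).integrable
  rw [ha.centred m] at h
  simpa [realCoeff] using h

/-- The covariance of the field along the meridian. -/
lemma IsIsotropicCoeff.sum_profile_mul_momentMatrix (ha : IsIsotropicCoeff P l C a) (u v : ℝ) :
    ∑ i, ∑ j, profile l i u * momentMatrix P (realCoeff a) i j * profile l j v =
      C * ((2 * (l : ℝ) + 1) / (4 * Real.pi) *
        (legendre l).eval (Real.cos ((u - v) * (Real.pi / 2)))) := by
  have hL : ∀ m, MemLp (realCoeff a m) 2 P := fun m =>
    (ha.hasGaussianLaw_realCoeff.eval m).memLp_two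
  -- The hypothesis controls $E[a\overline{a'}]$, not products of real parts. As the field is almost
  -- surely real, the sum with real parts equals the complex one, and one factor may be conjugated.
  have hae : ∀ w : ℝ, ∀ᵐ ω ∂P, ((∑ m, profile l m w * realCoeff a m ω : ℝ) : ℂ) =
      ∑ m, a m ω * (profile l m w : ℂ) := by
    intro w
    filter_upwards [ha.real (spherePoint 0 (w * (Real.pi / 2)))] with ω hω
    rw [← component_spherePoint, component]
    have : componentC l a (spherePoint 0 (w * (Real.pi / 2))) ω =
        ∑ m, a m ω * (profile l m w : ℂ) := by
      simp only [componentC, sphericalHarmonic_spherePoint_zero, profile]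
    rw [← this]
    exact Complex.ext (by simp) (by simp [hω])
  have hconj : ∀ m, MemLp (fun ω => (starRingEnd ℂ) (a m ω)) 2 P := fun m =>
    ((ha.gaussian.eval m).map_fun Complex.conjCLE.toContinuousLinearMap).memLp_two
  have hInt : ∀ m n, Integrable (fun ω => a m ω * (starRingEnd ℂ) (a n ω)) P := fun m n =>
    (ha.gaussian.eval m).memLp_two.integrable_mul (hconj n)
  rw [← integral_sum_mul_sum hL, ← Complex.ofReal_inj, ← integral_complex_ofReal]
  have e1 : ∫ ω, (((∑ i, profile l i u * realCoeff a i ω) *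
      (∑ j, profile l j v * realCoeff a j ω) : ℝ) : ℂ) ∂P =
      ∫ ω, ∑ m, ∑ n, ((profile l m u * profile l n v : ℝ) : ℂ) *
        (a m ω * (starRingEnd ℂ) (a n ω)) ∂P := by
    refine integral_congr_ae ?_
    filter_upwards [hae u, hae v] with ω h1 h2
    rw [Complex.ofReal_mul, h1, ← Complex.conj_ofReal (∑ j, _), h2, map_sum, Finset.sum_mul_sum]
    refine Finset.sum_congr rfl fun m _ => Finset.sum_congr rfl fun n _ => ?_
    rw [map_mul, Complex.conj_ofReal]
    push_cast
    ring
  rw [e1, integral_finsetSum _ fun i _ => integrable_finsetSum _ fun j _ => (hInt i j).const_mul _]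
  have e2 : ∀ m, ∫ ω, ∑ n, ((profile l m u * profile l n v : ℝ) : ℂ) *
        (a m ω * (starRingEnd ℂ) (a n ω)) ∂P =
      ((C * (profile l m u * profile l m v) : ℝ) : ℂ) := by
    intro m
    rw [integral_finsetSum _ fun j _ => (hInt m j).const_mul _]
    simp_rw [integral_const_mul, ha.covariance]
    simp [mul_comm]
  simp_rw [e2]
  rw [← Complex.ofReal_sum, ← Finset.mul_sum]
  simp only [profile]
  rw [sum_meridianHarmonic_mul, ← sub_mul]

/-- The covariance of the derivative of the field along the meridian. -/
lemma IsIsotropicCoeff.sum_deriv_profile_mul_momentMatrix (ha : IsIsotropicCoeff P l C a)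
    (u v : ℝ) :
    ∑ i, ∑ j, deriv (profile l i) u * momentMatrix P (realCoeff a) i j * deriv (profile l j) v =
      C * ((2 * (l : ℝ) + 1) / (4 * Real.pi)) * (Real.pi / 2) ^ 2 * kernel l (u - v) := by
  have h1 : ∀ w, ∑ i, ∑ j, deriv (profile l i) u * momentMatrix P (realCoeff a) i j *
      profile l j w = C * ((2 * (l : ℝ) + 1) / (4 * Real.pi) *
        (-(Real.pi / 2) * (Real.sin ((u - w) * (Real.pi / 2)) *
        (Polynomial.derivative (legendre l)).eval (Real.cos ((u - w) * (Real.pi / 2)))))) := by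
    intro w
    have d1 : HasDerivAt (fun s => ∑ i, ∑ j, profile l i s *
        momentMatrix P (realCoeff a) i j * profile l j w)
        (∑ i, ∑ j, deriv (profile l i) u * momentMatrix P (realCoeff a) i j * profile l j w) u :=
      HasDerivAt.fun_sum fun i _ => HasDerivAt.fun_sum fun j _ =>
        ((hasDerivAt_profile l i u).mul_const _).mul_const _
    simp_rw [fun s => ha.sum_profile_mul_momentMatrix s w] at d1
    exact d1.unique ((((hasDerivAt_legendre_cos l (u - w)).comp_sub_const u w).const_mul
      _).const_mul _)
  have d2 : HasDerivAt (fun s => ∑ i, ∑ j, deriv (profile l i) u *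
      momentMatrix P (realCoeff a) i j * profile l j s)
      (∑ i, ∑ j, deriv (profile l i) u * momentMatrix P (realCoeff a) i j *
        deriv (profile l j) v) v :=
    HasDerivAt.fun_sum fun i _ => HasDerivAt.fun_sum fun j _ =>
      (hasDerivAt_profile l j v).const_mul _
  simp_rw [h1] at d2
  -- Differentiating $u-v$ in $v$ gives a sign that cancels the minus in $-(\pi/2)^2 g_\ell$.
  rw [d2.unique ((((hasDerivAt_deriv_legendre_cos l (u - v)).comp_const_sub u v).const_mul
      _).const_mul _)]
  ring

open Matrix in
lemma IsIsotropicCoeff.trace_pow (ha : IsIsotropicCoeff P l C a) (n : ℕ) :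
    ((gramMatrix l * momentMatrix P (realCoeff a)) ^ (n + 1)).trace =
      (C * ((2 * (l : ℝ) + 1) / (4 * Real.pi)) * (Real.pi / 2) ^ 2) ^ (n + 1) *
        cyclicIntegral l (n + 1) := by
  have hc := continuous_deriv_profile l
  have h := integral_cyclic_prod_eq_trace (fun i => deriv (profile l i))
    (fun i v => ∑ j, momentMatrix P (realCoeff a) i j * deriv (profile l j) v) hc
    (fun i => by fun_prop) n
  have hM : gramMatrix l * momentMatrix P (realCoeff a) = Matrix.of fun i j =>
      ∫ u in (0 : ℝ)..1, deriv (profile l i) u *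
        ∑ k, momentMatrix P (realCoeff a) j k * deriv (profile l k) u := by
    ext i j
    simp_rw [Finset.mul_sum]
    rw [Matrix.of_apply, Matrix.mul_apply, intervalIntegral.integral_finsetSum fun i _ =>
        Continuous.intervalIntegrable (by fun_prop) _ _]
    refine Finset.sum_congr rfl fun k _ => ?_
    rw [gramMatrix, of_apply, ← intervalIntegral.integral_mul_const]
    congr 1
    ext u
    have : momentMatrix P (realCoeff a) k j = momentMatrix P (realCoeff a) j k := by
      simp [momentMatrix, mul_comm]
    rw [this]
    ring
  rw [hM, ← h, cyclicIntegral, ← integral_const_mul]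
  refine integral_congr_ae (Eventually.of_forall fun x => ?_)
  have e : ∀ s t : ℝ, ∑ i, deriv (profile l i) s *
      ∑ j, momentMatrix P (realCoeff a) i j * deriv (profile l j) t =
      C * ((2 * (l : ℝ) + 1) / (4 * Real.pi)) * (Real.pi / 2) ^ 2 * kernel l |s - t| := by
    intro s t
    rw [kernel_abs, ← ha.sum_deriv_profile_mul_momentMatrix]
    simp_rw [Finset.mul_sum, mul_assoc]
  simp only [e, Finset.prod_mul_distrib, Finset.prod_const, Finset.card_univ, Fintype.card_fin,
    mul_pow]

lemma IsIsotropicCoeff.memLp_realCoeff_mul (ha : IsIsotropicCoeff P l C a) (i j : Orders l) :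
    MemLp (fun ω => realCoeff a i ω * realCoeff a j ω) 2 P := by
  have : ENNReal.HolderTriple 4 4 2 := ⟨by
    rw [← two_mul, show (4 : ENNReal) = 2 * 2 by norm_num, ENNReal.mul_inv (by simp) (by simp),
      ← mul_assoc, ENNReal.mul_inv_cancel (by simp) (by simp), one_mul]⟩
  exact ((ha.hasGaussianLaw_realCoeff.eval j).memLp (p := 4) (by simp)).mul
    ((ha.hasGaussianLaw_realCoeff.eval i).memLp (p := 4) (by simp))

/-- The standardised integrated square of the derivative of the field along the meridian. -/
def limitVar (P : Measure Ω) (a : Orders l → Ω → ℂ) (ω : Ω) : ℝ :=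
  (quadForm (realCoeff a) (gramMatrix l) ω -
      ∫ ω', quadForm (realCoeff a) (gramMatrix l) ω' ∂P) /
    Real.sqrt (variance (quadForm (realCoeff a) (gramMatrix l)) P)

lemma normQuadVar_eq (P : Measure Ω) (a : Orders l → Ω → ℂ) {N : ℕ} (hN : 0 < N) (ω : Ω) :
    normQuadVar P l a N ω =
      (quadForm (realCoeff a) (incrementMatrix l N) ω -
        ∫ ω', quadForm (realCoeff a) (incrementMatrix l N) ω' ∂P) /
      Real.sqrt (variance (quadForm (realCoeff a) (incrementMatrix l N)) P) := by
  have hN' : (0 : ℝ) < N := by exact_mod_cast hN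
  have e : quadForm (realCoeff a) (incrementMatrix l N) = fun ω => (N : ℝ) * quadVar l a N ω := by
    ext ω
    rw [mul_quadVar]
  rw [e, integral_const_mul, variance_const_mul, Real.sqrt_mul (sq_nonneg _), Real.sqrt_sq hN'.le,
    ← mul_sub, mul_div_mul_left _ _ hN'.ne']
  rfl

lemma IsIsotropicCoeff.aemeasurable_quadForm (ha : IsIsotropicCoeff P l C a)
    (G : Matrix (Orders l) (Orders l) ℝ) : AEMeasurable (quadForm (realCoeff a) G) P := by
  have := fun i j => (ha.memLp_realCoeff_mul i j).aemeasurable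
  unfold quadForm
  fun_prop

lemma IsIsotropicCoeff.aemeasurable_normQuadVar (ha : IsIsotropicCoeff P l C a) (N : ℕ) :
    AEMeasurable (normQuadVar P l a N) P := by
  rcases Nat.eq_zero_or_pos N with rfl | hN
  · have : normQuadVar P l a 0 = fun _ => 0 := by
      ext ω
      simp [normQuadVar, quadVar]
    rw [this]
    fun_prop
  · rw [funext (normQuadVar_eq P a hN)]
    exact ((ha.aemeasurable_quadForm _).sub_const _).div_const _

lemma IsIsotropicCoeff.tendsto_normQuadVar [IsProbabilityMeasure P]
    (ha : IsIsotropicCoeff P l C a)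
    (hv : 0 < variance (quadForm (realCoeff a) (gramMatrix l)) P) (ω : Ω) :
    Tendsto (fun N => normQuadVar P l a N ω) atTop (𝓝 (limitVar P a ω)) := by
  have hG : ∀ i j, Tendsto (fun N => incrementMatrix l N i j) atTop (𝓝 (gramMatrix l i j)) :=
    fun i j => tendsto_sum_increment_mul (hasDerivAt_profile l i) (hasDerivAt_profile l j)
      (continuous_deriv_profile l i) (continuous_deriv_profile l j)
  have h := ((tendsto_quadForm (realCoeff a) hG ω).sub (tendsto_integral_quadForm
    (fun i j => (ha.memLp_realCoeff_mul i j).integrable (by norm_num)) hG)).div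
    (tendsto_variance_quadForm ha.memLp_realCoeff_mul hG).sqrt (Real.sqrt_pos.mpr hv).ne'
  refine h.congr' ?_
  filter_upwards [eventually_gt_atTop 0] with N hN
  rw [normQuadVar_eq P a hN ω]
  rfl

/-- The power sums of the $d_i$ are cyclic integrals times $c^p$. The case $p=2$ fixes the standard
deviation as $c\sqrt{2\int\!\!\int g_\ell^2}$. -/
lemma IsIsotropicCoeff.cumulant_limitVar [IsProbabilityMeasure P]
    (ha : IsIsotropicCoeff P l C a) (hl : 1 ≤ l) (hC : 0 < C) :
    0 < variance (quadForm (realCoeff a) (gramMatrix l)) P ∧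
      (0 : ℝ) ∈ interior (integrableExpSet id (P.map (limitVar P a))) ∧
      cumulant 1 (P.map (limitVar P a)) = 0 ∧
      0 < cumulant 4 (P.map (limitVar P a)) ∧
      ∀ p : ℕ, 2 ≤ p → cumulant p (P.map (limitVar P a)) =
        (2 : ℝ) ^ (p - 1) * ((p - 1).factorial : ℝ) /
            ((2 : ℝ) ^ ((p : ℝ) / 2) * kernelSq l ^ ((p : ℝ) / 2)) * cyclicIntegral l p := by
  obtain ⟨η, d, hm, hind, hη, hq, ht⟩ := exists_quadForm_eq_sum_sq
    ha.hasGaussianLaw_realCoeff ha.integral_realCoeff (posSemidef_gramMatrix l)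
  obtain ⟨hE, hV⟩ := integral_variance_sum_sq_gaussian hm hind hη
  set c : ℝ := C * ((2 * (l : ℝ) + 1) / (4 * Real.pi)) * (Real.pi / 2) ^ 2 with hc
  have hc0 : 0 < c := by
    have := Real.pi_pos
    positivity
  have hk := kernelSq_pos hl
  have hsum : ∀ n : ℕ, ∑ i, (d i : ℝ) ^ (n + 1) = c ^ (n + 1) * cyclicIntegral l (n + 1) :=
    fun n => by rw [ht, ha.trace_pow]
  have hqf : quadForm (realCoeff a) (gramMatrix l) = fun ω => ∑ i, η i ω ^ 2 := funext hq
  have hvar : variance (quadForm (realCoeff a) (gramMatrix l)) P = c ^ 2 * (2 * kernelSq l) := by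
    rw [hqf, hV, hsum 1, kernelSq_eq_cyclicIntegral]
    ring
  have hvar0 : 0 < variance (quadForm (realCoeff a) (gramMatrix l)) P := by
    rw [hvar]
    positivity
  set s := Real.sqrt (variance (quadForm (realCoeff a) (gramMatrix l)) P) with hs
  have hF : limitVar P a = fun ω => (∑ i, η i ω ^ 2 - ∑ i, (d i : ℝ)) / s := by
    ext ω
    rw [limitVar, hq, ← hs, ← hE, hqf]
  obtain ⟨h1, h2⟩ := cumulant_standardized_sum_sq hm hind hη (∑ i, (d i : ℝ)) s
  rw [hF]
  refine ⟨hvar0, h1, ?_, ?_, fun p hp => ?_⟩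
  · rw [h2 0]
    simp [Finset.sum_div]
  · have hs0 : 0 < s := Real.sqrt_pos.mpr hvar0
    -- Some $d_i$ is nonzero because $\sum_i d_i^2=c^2\int\!\!\int g_\ell^2>0$; the fourth cumulant
    -- is then a positive multiple of $\sum_i (d_i/s)^4>0$.
    obtain ⟨i, -, hi⟩ : ∃ i ∈ Finset.univ, (d i : ℝ) ^ 2 ≠ 0 := by
      refine Finset.exists_ne_zero_of_sum_ne_zero ?_
      rw [hsum 1, ← kernelSq_eq_cyclicIntegral]
      positivity
    have hi' : 0 < (d i : ℝ) :=
      lt_of_le_of_ne (d i).coe_nonneg fun h => hi (by rw [← h]; norm_num)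
    have h4 : 0 < ∑ i, ((d i : ℝ) / s) ^ (3 + 1) :=
      Finset.sum_pos' (fun j _ => by positivity) ⟨i, Finset.mem_univ _, by positivity⟩
    rw [h2 3, if_neg (by norm_num), sub_zero]
    positivity
  · obtain ⟨n, rfl⟩ : ∃ n, p = n + 1 := ⟨p - 1, by omega⟩
    -- The factor $c^p$, which holds all dependence on $C_\ell$, cancels against the one in the
    -- power sum.
    have hsp : s ^ (n + 1) = c ^ (n + 1) * ((2 : ℝ) ^ (((n + 1 : ℕ) : ℝ) / 2) *
        kernelSq l ^ (((n + 1 : ℕ) : ℝ) / 2)) := by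
      rw [hs, hvar, Real.sqrt_mul (sq_nonneg _), Real.sqrt_sq hc0.le, mul_pow,
        ← Real.mul_rpow (by norm_num) hk.le, Real.sqrt_eq_rpow, ← Real.rpow_mul_natCast
          (by positivity)]
      congr 2
      ring
    rw [h2, if_neg (by omega), sub_zero, Nat.add_sub_cancel]
    simp_rw [div_pow]
    rw [← Finset.sum_div, hsum, hsp, mul_div_mul_left _ _ (by positivity)]
    ring

end

end SphereQV

end

theorem theorem4p1 {Ω : Type*} [MeasurableSpace Ω] (P : Measure Ω) [IsProbabilityMeasure P]
    (l : ℕ) (hl : 1 ≤ l) (C : ℝ) (hC : 0 < C) (a : SphereQV.Orders l → Ω → ℂ)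
    (ha : SphereQV.IsIsotropicCoeff P l C a) :
    ∃ (μ : Measure ℝ) (_ : IsProbabilityMeasure μ),
      TendstoInDistribution (fun N : ℕ => SphereQV.normQuadVar P l a N) atTop (id : ℝ → ℝ)
        (fun _ => P) μ ∧
      (0 : ℝ) ∈ interior (integrableExpSet (id : ℝ → ℝ) μ) ∧
      (∀ (b : ℝ) (v : NNReal), μ ≠ gaussianReal b v) ∧
      SphereQV.cumulant 1 μ = 0 ∧
      SphereQV.cumulant 2 μ = 1 ∧
      ∀ p : ℕ, 3 ≤ p →
        SphereQV.cumulant p μ =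
          (2 : ℝ) ^ (p - 1) * ((p - 1).factorial : ℝ) /
            ((2 : ℝ) ^ ((p : ℝ) / 2) * SphereQV.kernelSq l ^ ((p : ℝ) / 2)) *
            SphereQV.cyclicIntegral l p := by
  have hm : AEMeasurable (SphereQV.limitVar P a) P :=
    ((ha.aemeasurable_quadForm _).sub_const _).div_const _
  obtain ⟨hv, hexp, h1, h4, hp⟩ := ha.cumulant_limitVar hl hC
  have hprob : IsProbabilityMeasure (P.map (SphereQV.limitVar P a)) :=
    Measure.isProbabilityMeasure_map hm
  have hk := SphereQV.kernelSq_pos hl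
  have h2 : SphereQV.cumulant 2 (P.map (SphereQV.limitVar P a)) = 1 := by
    rw [hp 2 le_rfl, ← SphereQV.kernelSq_eq_cyclicIntegral]
    simp
    field_simp
  refine ⟨P.map (SphereQV.limitVar P a), hprob, ?_, hexp, fun b v h => ?_, h1, h2,
    fun p hp3 => hp p (by omega)⟩
  · have h := tendstoInDistribution_of_ae_tendsto ha.aemeasurable_normQuadVar hm
      (Eventually.of_forall fun ω => ha.tendsto_normQuadVar hv ω)
    exact ⟨h.forall_aemeasurable, aemeasurable_id, by simpa using h.tendsto⟩
  · rw [h, SphereQV.cumulant_four_gaussianReal] at h4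
    exact lt_irrefl _ h4
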